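/- Let $a<b$ be real numbers, let $f_1,\dots,f_n:[a,b]\to\mathbb R$ be nonconstant Lipschitz functions with $f_i(a)=0$, put $F=(f_1,\dots,f_n):[a,b]\to\mathbb R^n$ and $\Gamma_F=F([a,b])$. Assume that $\Gamma_F$ is Lipschitz triangulable, i.e. it is a union of finitely many arcs $\gamma_i$ such that, for $i\ne j$, $\gamma_i\cap\gamma_j$ is empty or consists of a single common endpoint, and each $\gamma_i$ is parametrized by an injective Lipschitz map $h_i:[0,1]\to\gamma_i$ whose inverse $h_i^{-1}:\gamma_i\to[0,1]$ is locally Lipschitz apart from the endpoints of $\gamma_i$. Suppose that $\Gamma_F$ contains no subset homeomorphic to a circle and that $F$ is a closed path, i.e. $F(a)=F(b)$. Then the equation $$\frac{dv}{dt}=\sum_{j=1}^n f_j'\,v^{j+1}$$ determines a universal center, which means that: (a) the loop $F:[a,b]\to\Gamma_F$ represents the unit element of $\pi_1(\Gamma_F)$; (b$'$) there are a finite tree $T$ and continuous maps $\tilde F:T\to\Gamma_F$ and $\tilde f:[a,b]\to T$ with $\tilde f(a)=\tilde f(b)$ such that $F=\tilde F\circ\tilde f$; (c) for all $k\ge 1$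 and all $i_1,\dots,i_k\in\{1,\dots,n\}$, $$\int\cdots\int_{a\le t_1\le\cdots\le t_k\le b} f_{i_k}'(t_k)\cdots f_{i_1}'(t_1)\,dt_k\cdots dt_1=0 .$$ -/

import Mathlib

open Set Topology MeasureTheory
open scoped NNReal unitInterval

noncomputable section

/-- The path `F = (f₁, …, fₙ)` in `ℝⁿ`. -/
def pathOf {n : ℕ} (f : Fin n → ℝ → ℝ) (t : ℝ) : EuclideanSpace ℝ (Fin n) :=
  WithLp.toLp 2 (fun i => f i t)

/-- The image `Γ_F = F([a, b])`. -/
def imageCurve {n : ℕ} (a b : ℝ) (f : Fin n → ℝ → ℝ) : Set (EuclideanSpace ℝ (Fin n)) :=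
  pathOf f '' Icc a b

/-- `h` restricted to `[0, 1]` is a Lipschitz parametrization of an arc whose inverse (defined on
the arc) is locally Lipschitz apart from the endpoints of the arc.
(The left inverse makes `h` injective on `[0, 1]`.) -/
def IsLipschitzArc {E : Type*} [PseudoEMetricSpace E] (h : ℝ → E) : Prop :=
  (∃ K : ℝ≥0, LipschitzOnWith K h (Icc 0 1)) ∧
  ∃ g : E → ℝ, LeftInvOn g h (Icc 0 1) ∧ LocallyLipschitzOn (h '' Ioo 0 1) g

/-- A Lipschitz triangulable curve: a finite union of such arcs, two different ones of which are
disjoint or meet in exactly one point, which is an endpoint of both. -/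
def IsLipschitzTriangulable {E : Type*} [PseudoEMetricSpace E] (Γ : Set E) : Prop :=
  ∃ (m : ℕ) (h : Fin m → ℝ → E),
    (∀ i, IsLipschitzArc (h i)) ∧
    Γ = ⋃ i, h i '' Icc 0 1 ∧
    ∀ i j, i ≠ j →
      h i '' Icc 0 1 ∩ h j '' Icc 0 1 = ∅ ∨
      ∃ p ∈ ({h i 0, h i 1} ∩ {h j 0, h j 1} : Set E),
        h i '' Icc 0 1 ∩ h j '' Icc 0 1 = {p}

/-- No subset of `Γ` is homeomorphic to a circle. -/
def ContainsNoCircle {E : Type*} [TopologicalSpace E] (Γ : Set E) : Prop :=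
  ∀ S ⊆ Γ, ¬ Nonempty (S ≃ₜ Circle)

/-- The geometric realization of a finite graph: the vertices are the standard basis vectors of
`ℝ^V`, and the edges are the straight segments between adjacent vertices. -/
def graphRealization {V : Type*} [DecidableEq V] (G : SimpleGraph V) : Set (V → ℝ) :=
  (⋃ v, {Pi.single v 1}) ∪
    ⋃ (u) (v) (_ : G.Adj u v), segment ℝ (Pi.single u (1 : ℝ)) (Pi.single v 1)

/-- The path `F : [a, b] → Γ_F`, reparametrized affinely over `[0, 1]`, is a loop in `Γ_F` that
represents the unit element of the fundamental group of `Γ_F`. -/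
def IsContractibleLoop {n : ℕ} (a b : ℝ) (f : Fin n → ℝ → ℝ) : Prop :=
  ∃ (x₀ : imageCurve a b f) (p : Path x₀ x₀),
    (∀ t : I, (p t : EuclideanSpace ℝ (Fin n)) = pathOf f (a + t * (b - a))) ∧
    FundamentalGroup.fromPath (Path.Homotopic.Quotient.mk p) = 1

/-- The tree composition condition: `F = Φ ∘ τ` on `[a, b]`, where `τ : [a, b] → T` and
`Φ : T → Γ_F` are continuous, `T` is a finite tree and `τ a = τ b`. -/
def TreeCompositionCondition {n : ℕ} (a b : ℝ) (f : Fin n → ℝ → ℝ) : Prop :=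
  ∃ (k : ℕ) (G : SimpleGraph (Fin k)), G.IsTree ∧
    ∃ (τ : ℝ → Fin k → ℝ) (Φ : (Fin k → ℝ) → EuclideanSpace ℝ (Fin n)),
      ContinuousOn τ (Icc a b) ∧ MapsTo τ (Icc a b) (graphRealization G) ∧
      ContinuousOn Φ (graphRealization G) ∧
      MapsTo Φ (graphRealization G) (imageCurve a b f) ∧
      τ a = τ b ∧ ∀ t ∈ Icc a b, pathOf f t = Φ (τ t)

/-- The iterated integral over `a ≤ t₁ ≤ ⋯ ≤ t_k ≤ t` of
`f'_{i_k}(t_k) ⋯ f'_{i_1}(t_1)`, for the word `[i_k, …, i_1]` (outermost letter first). -/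
def iteratedIntegral {n : ℕ} (a : ℝ) (f : Fin n → ℝ → ℝ) : List (Fin n) → ℝ → ℝ
  | [], _ => 1
  | i :: w, t => ∫ s in a..t, deriv (f i) s * iteratedIntegral a f w s

/-- All iterated integrals of order at least one of `f'₁, …, f'ₙ` over `[a, b]` vanish. -/
def IteratedIntegralsVanish {n : ℕ} (a b : ℝ) (f : Fin n → ℝ → ℝ) : Prop :=
  ∀ w : List (Fin n), w ≠ [] → iteratedIntegral a f w b = 0

/-- The equation `dv/dt = ∑ⱼ f'ⱼ v^(j+1)` on `[a, b]` determines a universal center. The three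
conditions are the equivalent ones that characterize it; all of them are required. -/
def DeterminesUniversalCenter {n : ℕ} (a b : ℝ) (f : Fin n → ℝ → ℝ) : Prop :=
  IsContractibleLoop a b f ∧ TreeCompositionCondition a b f ∧ IteratedIntegralsVanish a b f

end

/-! The curve is connected and contains no circle, so its arcs can be ordered so that each meets the
union of the earlier ones in exactly one of its endpoints
(`IsLipschitzTriangulable.exists_isArcTree`). All three conditions follow from this tree structure
`IsArcTree` by induction on the attachments.

For (a), arcs are contracted one at a time into their roots. For (b'), attaching an arc corresponds
to adding a leaf to a finite tree; this gives a homeomorphism `Ψ` from the curve onto the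
realization of the tree, and `F` factors as `Ψ⁻¹ ∘ (Ψ ∘ F)`.

For (c), induction on the word shows that an iterated integral takes equal values at times with
equal `F`. It is then `φ ∘ F` with `φ` continuous on the curve, and the next integral changes
between two such times by `∫ φ(F) dFᵢ` over a loop. This vanishes on a tree
(`IsArcTree.integral_loop_eq_zero`): if `φ` oscillates little on a piece, the integral over a loop
there is at most `ε` times the variation. Gluing pieces at one point preserves this bound with the
same `ε`, because a loop splits into its truncations to the two pieces, whose variations add up
exactly; the time spent at the common point contributes nothing. Then `ε → 0`. -/

theorem ae_deriv_eq_zero_of_eq_const (g : ℝ → ℝ) (c : ℝ) : ∀ᵐ t, g t = c → deriv g t = 0 := by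
  -- Only countably many points of the level set are isolated in it from the right; at any other
  -- one, difference quotients along the level set are zero.
  have hcount := countable_setOfPred_isolated_right_within (s := {t | g t = c})
  filter_upwards [hcount.ae_notMem volume] with t ht hgt
  by_cases hd : DifferentiableAt ℝ g t
  · have hne : (𝓝[{t | g t = c} ∩ Ioi t] t).NeBot := ⟨fun h => ht ⟨hgt, h⟩⟩
    have h1 : HasDerivWithinAt g (deriv g t) ({t | g t = c} ∩ Ioi t) t :=
      hd.hasDerivAt.hasDerivWithinAt
    rw [hasDerivWithinAt_iff_tendsto_slope' (by simp)] at h1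
    refine tendsto_nhds_unique h1 (tendsto_const_nhds.congr' ?_)
    filter_upwards [self_mem_nhdsWithin] with y hy
    have hy1 : g y = c := hy.1
    simp [slope, hy1, hgt]
  · exact deriv_zero_of_not_differentiableAt hd

/-! ### Truncation of a path at a cut point -/

section Retraction

variable {E : Type*} {Γ₁ Γ₂ : Set E} {p : E} {F : ℝ → E} {s t : ℝ} {K : ℝ≥0}

/-- The path `F`, with its excursions out of `Γ` replaced by the constant `p`. -/
noncomputable def truncateTo (Γ : Set E) (p : E) (F : ℝ → E) (x : ℝ) : E :=
  open Classical in if F x ∈ Γ then F x else p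

theorem truncateTo_of_mem {Γ : Set E} {x : ℝ} (h : F x ∈ Γ) : truncateTo Γ p F x = F x := if_pos h

theorem truncateTo_of_notMem {Γ : Set E} {x : ℝ} (h : F x ∉ Γ) : truncateTo Γ p F x = p := if_neg h

theorem mapsTo_truncateTo {Γ : Set E} (hp : p ∈ Γ) (S : Set ℝ) : MapsTo (truncateTo Γ p F) S Γ := by
  intro x _
  by_cases h : F x ∈ Γ
  · rwa [truncateTo_of_mem h]
  · rwa [truncateTo_of_notMem h]

theorem truncateTo_eq_of_eq {Γ : Set E} (h : F s = F t) :
    truncateTo Γ p F s = truncateTo Γ p F t := by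
  by_cases hs : F s ∈ Γ
  · rw [truncateTo_of_mem hs, truncateTo_of_mem (h ▸ hs), h]
  · rw [truncateTo_of_notMem hs, truncateTo_of_notMem (h ▸ hs)]

variable [MetricSpace E]

/-- A path that leaves `Γ₁` for `Γ₂` passes through their only common point. -/
theorem exists_mem_Icc_eq (h₁ : IsClosed Γ₁) (h₂ : IsClosed Γ₂) (hp : Γ₁ ∩ Γ₂ = {p})
    (hF : ContinuousOn F (Icc s t)) (hm : MapsTo F (Icc s t) (Γ₁ ∪ Γ₂)) {x y : ℝ} (hx : x ∈ Icc s t)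
    (hy : y ∈ Icc s t) (hFx : F x ∈ Γ₁) (hFy : F y ∈ Γ₂) : ∃ m ∈ uIcc x y, F m = p := by
  have hsub : uIcc x y ⊆ Icc s t := uIcc_subset_Icc hx hy
  have hc : IsPreconnected (F '' uIcc x y) := isPreconnected_uIcc.image F (hF.mono hsub)
  obtain ⟨z, ⟨m, hm', rfl⟩, hz⟩ := isPreconnected_closed_iff.1 hc Γ₁ Γ₂ h₁ h₂
    (by rintro _ ⟨m, hm', rfl⟩; exact hm (hsub hm')) ⟨F x, ⟨x, left_mem_uIcc, rfl⟩, hFx⟩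
    ⟨F y, ⟨y, right_mem_uIcc, rfl⟩, hFy⟩
  rw [hp] at hz
  exact ⟨m, hm', hz⟩

/-- The constant does not grow: between a time in `Γ₁` and a time outside, the path visits `p`, at a
time no farther from the first than the second is. -/
theorem lipschitzOnWith_truncateTo (h₁ : IsClosed Γ₁) (h₂ : IsClosed Γ₂) (hp : Γ₁ ∩ Γ₂ = {p})
    (hF : LipschitzOnWith K F (Icc s t)) (hm : MapsTo F (Icc s t) (Γ₁ ∪ Γ₂)) :
    LipschitzOnWith K (truncateTo Γ₁ p F) (Icc s t) := by
  have key : ∀ x ∈ Icc s t, ∀ y ∈ Icc s t, F x ∈ Γ₁ → F y ∉ Γ₁ → dist (F x) p ≤ K * dist x y := by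
    intro x hx y hy hFx hFy
    obtain ⟨m, hm', rfl⟩ := exists_mem_Icc_eq h₁ h₂ hp hF.continuousOn hm hx hy hFx
      ((hm hy).resolve_left hFy)
    refine (hF.dist_le_mul x hx m (uIcc_subset_Icc hx hy hm')).trans ?_
    gcongr
    rw [dist_comm x m, dist_comm x y]
    exact Real.dist_left_le_of_mem_uIcc hm' |>.trans_eq' (dist_comm _ _) |>.trans_eq (dist_comm _ _)
  refine LipschitzOnWith.of_dist_le_mul fun x hx y hy => ?_
  by_cases hFx : F x ∈ Γ₁ <;> by_cases hFy : F y ∈ Γ₁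
  · rw [truncateTo_of_mem hFx, truncateTo_of_mem hFy]
    exact hF.dist_le_mul x hx y hy
  · rw [truncateTo_of_mem hFx, truncateTo_of_notMem hFy]
    exact key x hx y hy hFx hFy
  · rw [truncateTo_of_notMem hFx, truncateTo_of_mem hFy, dist_comm, dist_comm x]
    exact key y hy x hx hFy hFx
  · rw [truncateTo_of_notMem hFx, truncateTo_of_notMem hFy, dist_self]
    positivity

/-- While `F` is outside `Γ₂`, it agrees with its truncation to `Γ₁` and its truncation to `Γ₂`
is constant. -/
theorem truncateTo_eventuallyEq (h₂ : IsClosed Γ₂) (hF : ContinuousOn F (Icc s t))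
    (hm : MapsTo F (Icc s t) (Γ₁ ∪ Γ₂)) {x : ℝ} (hx : x ∈ Ioo s t) (hFx : F x ∉ Γ₂) :
    truncateTo Γ₁ p F =ᶠ[𝓝 x] F ∧ truncateTo Γ₂ p F =ᶠ[𝓝 x] fun _ => p := by
  have hc : ContinuousAt F x := hF.continuousAt (Icc_mem_nhds hx.1 hx.2)
  have hev : ∀ᶠ y in 𝓝 x, F y ∉ Γ₂ := hc.eventually (h₂.isOpen_compl.mem_nhds hFx)
  constructor
  · filter_upwards [hev, Icc_mem_nhds hx.1 hx.2] with y hy hy'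
    exact truncateTo_of_mem ((hm hy').resolve_right hy)
  · filter_upwards [hev] with y hy
    exact truncateTo_of_notMem hy

end Retraction

/-! ### Integrals of one-forms along loops -/

section LoopIntegral

variable {E : Type*} [MetricSpace E] {φ ℓ : E → ℝ} {ε : ℝ} {Γ Γ₁ Γ₂ : Set E}

/-- The integral of `φ dℓ` over each Lipschitz loop in `Γ` is at most `ε` times the variation of `ℓ`
along the loop. -/
def LoopIntegralBound (φ ℓ : E → ℝ) (ε : ℝ) (Γ : Set E) : Prop :=
  ∀ ⦃s t : ℝ⦄, s ≤ t → ∀ (F : ℝ → E) (K : ℝ≥0), LipschitzOnWith K F (Icc s t) →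
    MapsTo F (Icc s t) Γ → F s = F t →
    |∫ x in s..t, φ (F x) * deriv (ℓ ∘ F) x| ≤ ε * ∫ x in s..t, |deriv (ℓ ∘ F) x|

theorem LipschitzWith.absolutelyContinuousOnInterval_comp {L K : ℝ≥0} (hℓ : LipschitzWith L ℓ)
    {s t : ℝ} (hst : s ≤ t) {F : ℝ → E} (hF : LipschitzOnWith K F (Icc s t)) :
    AbsolutelyContinuousOnInterval (ℓ ∘ F) s t := by
  rw [← uIcc_of_le hst] at hF
  exact (hℓ.comp_lipschitzOnWith hF).absolutelyContinuousOnInterval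

theorem intervalIntegrable_mul_deriv {L K : ℝ≥0} (hℓ : LipschitzWith L ℓ) {s t : ℝ} (hst : s ≤ t)
    {F : ℝ → E} (hF : LipschitzOnWith K F (Icc s t)) (hm : MapsTo F (Icc s t) Γ)
    (hφ : ContinuousOn φ Γ) :
    IntervalIntegrable (fun x => φ (F x) * deriv (ℓ ∘ F) x) volume s t := by
  refine (hℓ.absolutelyContinuousOnInterval_comp hst hF).intervalIntegrable_deriv.continuousOn_mul ?_
  rw [uIcc_of_le hst]
  exact hφ.comp hF.continuousOn hm

/-- Since `dℓ` integrates to zero over a loop, `φ` may be replaced by `φ - c`. -/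
theorem LoopIntegralBound.of_forall_abs_sub_le {L : ℝ≥0} (hℓ : LipschitzWith L ℓ)
    (hφ : ContinuousOn φ Γ) {c : ℝ} (hc : ∀ x ∈ Γ, |φ x - c| ≤ ε) : LoopIntegralBound φ ℓ ε Γ := by
  intro s t hst F K hF hm hloop
  have hac := hℓ.absolutelyContinuousOnInterval_comp hst hF
  have hint := hac.intervalIntegrable_deriv
  have h1 : ∫ x in s..t, φ (F x) * deriv (ℓ ∘ F) x
      = ∫ x in s..t, (φ (F x) - c) * deriv (ℓ ∘ F) x := by
    have : ∫ x in s..t, c * deriv (ℓ ∘ F) x = 0 := by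
      rw [intervalIntegral.integral_const_mul, hac.integral_deriv_eq_sub]
      simp [hloop]
    simp_rw [sub_mul]
    rw [intervalIntegral.integral_sub (intervalIntegrable_mul_deriv hℓ hst hF hm hφ)
      (hint.const_mul c), this, sub_zero]
  rw [h1, ← intervalIntegral.integral_const_mul, ← Real.norm_eq_abs]
  refine intervalIntegral.norm_integral_le_of_norm_le hst ?_ (hint.abs.const_mul ε)
  refine Filter.Eventually.of_forall fun x hx => ?_
  rw [norm_mul, Real.norm_eq_abs, Real.norm_eq_abs]
  gcongr
  exact hc _ (hm (Ioc_subset_Icc_self hx))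

/-- Both truncations of a loop are loops, and at almost every time at most one of them moves. Hence
the integral and the variation both split as sums, and `ε` is unchanged. -/
theorem LoopIntegralBound.union {L : ℝ≥0} (hℓ : LipschitzWith L ℓ) (h₁ : IsClosed Γ₁)
    (h₂ : IsClosed Γ₂) {p : E} (hp : Γ₁ ∩ Γ₂ = {p}) (hφ : ContinuousOn φ (Γ₁ ∪ Γ₂))
    (hb₁ : LoopIntegralBound φ ℓ ε Γ₁) (hb₂ : LoopIntegralBound φ ℓ ε Γ₂) :
    LoopIntegralBound φ ℓ ε (Γ₁ ∪ Γ₂) := by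
  intro s t hst F K hF hm hloop
  have hmem : p ∈ Γ₁ ∩ Γ₂ := hp ▸ mem_singleton p
  have hm' : MapsTo F (Icc s t) (Γ₂ ∪ Γ₁) := by rwa [union_comm]
  have hp' : Γ₂ ∩ Γ₁ = {p} := by rwa [inter_comm]
  set F₁ := truncateTo Γ₁ p F
  set F₂ := truncateTo Γ₂ p F
  have hl₁ : LipschitzOnWith K F₁ (Icc s t) := lipschitzOnWith_truncateTo h₁ h₂ hp hF hm
  have hl₂ : LipschitzOnWith K F₂ (Icc s t) := lipschitzOnWith_truncateTo h₂ h₁ hp' hF hm'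
  have hm₁ : MapsTo F₁ (Icc s t) Γ₁ := mapsTo_truncateTo hmem.1 _
  have hm₂ : MapsTo F₂ (Icc s t) Γ₂ := mapsTo_truncateTo hmem.2 _
  have hi₁ := (hℓ.absolutelyContinuousOnInterval_comp hst hl₁).intervalIntegrable_deriv.abs
  have hi₂ := (hℓ.absolutelyContinuousOnInterval_comp hst hl₂).intervalIntegrable_deriv.abs
  have hj₁ := intervalIntegrable_mul_deriv hℓ hst hl₁ hm₁ (hφ.mono subset_union_left)
  have hj₂ := intervalIntegrable_mul_deriv hℓ hst hl₂ hm₂ (hφ.mono subset_union_right)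
  have hae : ∀ᵐ x, x ∈ Ioo s t →
      φ (F x) * deriv (ℓ ∘ F) x
        = φ (F₁ x) * deriv (ℓ ∘ F₁) x + φ (F₂ x) * deriv (ℓ ∘ F₂) x ∧
      |deriv (ℓ ∘ F) x| = |deriv (ℓ ∘ F₁) x| + |deriv (ℓ ∘ F₂) x| := by
    filter_upwards [ae_deriv_eq_zero_of_eq_const (ℓ ∘ F) (ℓ p),
      ae_deriv_eq_zero_of_eq_const (ℓ ∘ F₁) (ℓ p),
      ae_deriv_eq_zero_of_eq_const (ℓ ∘ F₂) (ℓ p)] with x hx hx₁ hx₂ hxst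
    by_cases hF1 : F x ∈ Γ₁
    · by_cases hF2 : F x ∈ Γ₂
      -- At times spent at `p`, all three compositions with `ℓ` have the value `ℓ p`, so their
      -- derivatives vanish outside the null set already discarded.
      · have hxp : F x = p := by
          have : F x ∈ Γ₁ ∩ Γ₂ := ⟨hF1, hF2⟩
          rwa [hp] at this
        have e₁ : F₁ x = p := (truncateTo_of_mem hF1).trans hxp
        have e₂ : F₂ x = p := (truncateTo_of_mem hF2).trans hxp
        rw [hx (by simp [hxp]), hx₁ (by simp [e₁]), hx₂ (by simp [e₂])]
        simp
      · obtain ⟨e₁, e₂⟩ := truncateTo_eventuallyEq (p := p) h₂ hF.continuousOn hm hxst hF2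
        have d₁ : deriv (ℓ ∘ F₁) x = deriv (ℓ ∘ F) x := (e₁.fun_comp ℓ).deriv_eq
        have d₂ : deriv (ℓ ∘ F₂) x = 0 := (e₂.fun_comp ℓ).deriv_eq.trans (deriv_const x _)
        rw [d₁, d₂, show F₁ x = F x from e₁.eq_of_nhds]
        simp
    · obtain ⟨e₂, e₁⟩ := truncateTo_eventuallyEq (p := p) h₁ hF.continuousOn hm' hxst hF1
      have d₂ : deriv (ℓ ∘ F₂) x = deriv (ℓ ∘ F) x := (e₂.fun_comp ℓ).deriv_eq
      have d₁ : deriv (ℓ ∘ F₁) x = 0 := (e₁.fun_comp ℓ).deriv_eq.trans (deriv_const x _)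
      rw [d₁, d₂, show F₂ x = F x from e₂.eq_of_nhds]
      simp
  have hae' : ∀ᵐ x, x ∈ uIoc s t →
      φ (F x) * deriv (ℓ ∘ F) x
        = φ (F₁ x) * deriv (ℓ ∘ F₁) x + φ (F₂ x) * deriv (ℓ ∘ F₂) x ∧
      |deriv (ℓ ∘ F) x| = |deriv (ℓ ∘ F₁) x| + |deriv (ℓ ∘ F₂) x| := by
    filter_upwards [hae, (countable_singleton t).ae_notMem volume] with x hx hxt hxst
    rw [uIoc_of_le hst] at hxst
    exact hx ⟨hxst.1, lt_of_le_of_ne hxst.2 hxt⟩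
  rw [intervalIntegral.integral_congr_ae (hae'.mono fun x hx h => (hx h).1),
    intervalIntegral.integral_congr_ae (hae'.mono fun x hx h => (hx h).2),
    intervalIntegral.integral_add hj₁ hj₂, intervalIntegral.integral_add hi₁ hi₂, mul_add]
  exact (abs_add_le _ _).trans (add_le_add
    (hb₁ hst F₁ K hl₁ hm₁ (truncateTo_eq_of_eq hloop))
    (hb₂ hst F₂ K hl₂ hm₂ (truncateTo_eq_of_eq hloop)))

/-- By uniform continuity the arc can be cut into `N + 1` short subarcs on each of which `φ` is
within `ε` of a constant; by injectivity each meets the union of its predecessors in one point. -/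
theorem LoopIntegralBound.arc {L : ℝ≥0} (hℓ : LipschitzWith L ℓ) (hε : 0 < ε) {h : ℝ → E}
    (hc : ContinuousOn h (Icc 0 1)) (hinj : InjOn h (Icc 0 1))
    (hφ : ContinuousOn φ (h '' Icc 0 1)) : LoopIntegralBound φ ℓ ε (h '' Icc 0 1) := by
  have hu : UniformContinuousOn (φ ∘ h) (Icc 0 1) :=
    isCompact_Icc.uniformContinuousOn_of_continuous (hφ.comp hc (mapsTo_image _ _))
  obtain ⟨δ, hδ, hδ'⟩ := Metric.uniformContinuousOn_iff.1 hu ε hε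
  obtain ⟨N, hN⟩ := exists_nat_one_div_lt hδ
  have hN0 : (0 : ℝ) < N + 1 := by positivity
  have hclosed : ∀ c d : ℝ, Icc c d ⊆ Icc 0 1 → IsClosed (h '' Icc c d) := fun c d hcd =>
    (isCompact_Icc.image_of_continuousOn (hc.mono hcd)).isClosed
  have key : ∀ k : ℕ, k ≤ N + 1 → LoopIntegralBound φ ℓ ε (h '' Icc 0 (k / (N + 1 : ℝ))) := by
    intro k
    induction k with
    | zero =>
      intro _
      refine .of_forall_abs_sub_le hℓ (c := φ (h 0)) (hφ.mono (image_mono ?_)) ?_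
      · simp
      · rintro _ ⟨x, hx, rfl⟩
        have : x = 0 := by simpa using hx
        simp [this, hε.le]
    | succ k ih =>
      intro hk
      have hk1 : ((k + 1 : ℕ) : ℝ) / (N + 1) ≤ 1 := by
        rw [div_le_one hN0]; exact_mod_cast hk
      have hk0 : (0 : ℝ) ≤ k / (N + 1 : ℝ) := by positivity
      have hstep : ((k + 1 : ℕ) : ℝ) / (N + 1) = k / (N + 1 : ℝ) + 1 / (N + 1) := by
        push_cast; ring
      have hstep0 : (0 : ℝ) < 1 / (N + 1 : ℝ) := by positivity
      set c : ℝ := k / (N + 1 : ℝ)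
      set d : ℝ := ((k + 1 : ℕ) : ℝ) / (N + 1)
      have hcd : c ≤ d := by linarith
      have s1 : Icc 0 c ⊆ Icc (0 : ℝ) 1 := Icc_subset_Icc_right (hcd.trans hk1)
      have s2 : Icc c d ⊆ Icc (0 : ℝ) 1 := Icc_subset_Icc hk0 hk1
      rw [← Icc_union_Icc_eq_Icc hk0 hcd, image_union]
      refine .union hℓ (hclosed _ _ s1) (hclosed _ _ s2) (p := h c) ?_
        (hφ.mono (by rw [← image_union]; exact image_mono (union_subset s1 s2)))
        (ih (by omega)) ?_
      · rw [← hinj.image_inter s1 s2, Icc_inter_Icc_eq_singleton hk0 hcd, image_singleton]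
      · refine .of_forall_abs_sub_le hℓ (c := φ (h c)) (hφ.mono (image_mono s2)) ?_
        rintro _ ⟨x, hx, rfl⟩
        refine (hδ' x (s2 hx) c (s2 ⟨le_rfl, hcd⟩) ?_).le
        rw [Real.dist_eq, abs_of_nonneg (by linarith [hx.1])]
        linarith [hx.2]
  have := key (N + 1) le_rfl
  rwa [show ((N + 1 : ℕ) : ℝ) / (N + 1 : ℝ) = 1 by push_cast; exact div_self hN0.ne'] at this

end LoopIntegral

/-! ### Trees of arcs -/

/-- `Γ` is built from a point by attaching finitely many arcs, each at one of its endpoints to one of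
the previous vertices; `V` is the set of vertices. -/
inductive IsArcTree {E : Type*} [TopologicalSpace E] : Set E → Set E → Prop
  | point (x : E) : IsArcTree {x} {x}
  | attach {V Γ : Set E} (h : ℝ → E) : IsArcTree V Γ → ContinuousOn h (Icc 0 1) →
      InjOn h (Icc 0 1) → h 0 ∈ V → Γ ∩ h '' Icc 0 1 = {h 0} →
      IsArcTree (insert (h 1) V) (Γ ∪ h '' Icc 0 1)

namespace IsArcTree

section Topology

variable {E : Type*} [TopologicalSpace E] {V Γ : Set E}

theorem isCompact (hT : IsArcTree V Γ) : IsCompact Γ := by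
  induction hT with
  | point x => exact isCompact_singleton
  | attach h _ hc _ _ _ ih => exact ih.union (isCompact_Icc.image_of_continuousOn hc)

theorem subset (hT : IsArcTree V Γ) : V ⊆ Γ := by
  induction hT with
  | point x => exact Subset.rfl
  | attach h _ _ _ _ _ ih =>
    exact insert_subset (.inr ⟨1, by simp, rfl⟩) (ih.trans subset_union_left)

end Topology

variable {E : Type*} [MetricSpace E] {V Γ : Set E} {φ ℓ : E → ℝ}

theorem loopIntegralBound (hT : IsArcTree V Γ) {L : ℝ≥0} (hℓ : LipschitzWith L ℓ) {ε : ℝ}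
    (hε : 0 < ε) (hφ : ContinuousOn φ Γ) : LoopIntegralBound φ ℓ ε Γ := by
  induction hT with
  | point x => exact .of_forall_abs_sub_le hℓ (c := φ x) hφ (by simp [hε.le])
  | attach h hT hc hinj _ hp ih =>
    exact .union hℓ hT.isCompact.isClosed (isCompact_Icc.image_of_continuousOn hc).isClosed hp hφ
      (ih (hφ.mono subset_union_left)) (.arc hℓ hε hc hinj (hφ.mono subset_union_right))

theorem integral_loop_eq_zero (hT : IsArcTree V Γ) {L K : ℝ≥0} (hℓ : LipschitzWith L ℓ)
    (hφ : ContinuousOn φ Γ) {s t : ℝ} (hst : s ≤ t) {F : ℝ → E}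
    (hF : LipschitzOnWith K F (Icc s t)) (hm : MapsTo F (Icc s t) Γ) (hloop : F s = F t) :
    ∫ x in s..t, φ (F x) * deriv (ℓ ∘ F) x = 0 := by
  set C := ∫ x in s..t, |deriv (ℓ ∘ F) x|
  have hlim : Filter.Tendsto (fun ε : ℝ => ε * C) (𝓝[>] 0) (𝓝 0) := by
    have : Filter.Tendsto (fun ε : ℝ => ε * C) (𝓝 0) (𝓝 (0 * C)) :=
      Filter.tendsto_id.mul_const C
    rw [zero_mul] at this
    exact this.mono_left nhdsWithin_le_nhds
  rw [← abs_nonpos_iff]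
  refine ge_of_tendsto hlim ?_
  filter_upwards [self_mem_nhdsWithin] with ε hε
  exact hT.loopIntegralBound hℓ hε hφ hst F K hF hm hloop

end IsArcTree

/-- A continuous map from a compact set to a Hausdorff space is a quotient map onto its image, so
continuity of `φ` can be tested after composing with `F`. -/
theorem continuousOn_image_of_isCompact {X Y Z : Type*} [TopologicalSpace X] [T2Space X]
    [TopologicalSpace Y] [T2Space Y] [TopologicalSpace Z] {S : Set X} (hS : IsCompact S) {F : X → Y}
    (hF : ContinuousOn F S) {ψ : X → Z} (hψ : ContinuousOn ψ S) {φ : Y → Z}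
    (h : ∀ x ∈ S, φ (F x) = ψ x) : ContinuousOn φ (F '' S) := by
  refine continuousOn_iff_isClosed.2 fun C hC => ⟨F '' (S ∩ ψ ⁻¹' C), ?_, ?_⟩
  · exact ((hS.of_isClosed_subset (hψ.preimage_isClosed_of_isClosed hS.isClosed hC)
      inter_subset_left).image_of_continuousOn (hF.mono inter_subset_left)).isClosed
  · ext y
    constructor
    · rintro ⟨hy, x, hx, rfl⟩
      exact ⟨⟨x, ⟨hx, by rwa [mem_preimage, ← h x hx]⟩, rfl⟩, x, hx, rfl⟩
    · rintro ⟨⟨x, ⟨hx, hxC⟩, rfl⟩, -⟩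
      exact ⟨by rwa [mem_preimage, h x hx], x, hx, rfl⟩

/-! ### Vanishing of the iterated integrals -/

section IteratedIntegrals

variable {n : ℕ} {a b : ℝ} {f : Fin n → ℝ → ℝ}

theorem lipschitzOnWith_pathOf (hLip : ∀ i, ∃ K : ℝ≥0, LipschitzOnWith K (f i) (Icc a b)) :
    ∃ K : ℝ≥0, LipschitzOnWith K (pathOf f) (Icc a b) := by
  choose K hK using hLip
  have h1 : LipschitzOnWith (∑ i, K i) (fun t i => f i t) (Icc a b) := by
    refine LipschitzOnWith.of_dist_le_mul fun x hx y hy => ?_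
    refine (dist_pi_le_iff (by positivity)).2 fun i => ((hK i).dist_le_mul x hx y hy).trans ?_
    gcongr
    exact Finset.single_le_sum (f := K) (fun _ _ => zero_le) (Finset.mem_univ i)
  exact ⟨_, (PiLp.lipschitzWith_toLp 2 (fun _ : Fin n => ℝ)).comp_lipschitzOnWith h1⟩

theorem lipschitzWith_coord (i : Fin n) :
    LipschitzWith 1 (fun x : EuclideanSpace ℝ (Fin n) => x i) := by
  refine LipschitzWith.of_dist_le_mul fun x y => ?_
  rw [NNReal.coe_one, one_mul, dist_eq_norm, dist_eq_norm]
  exact PiLp.norm_apply_le (x - y) i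

/-- The two claims are proved together: equality at equal points lets the integral for `w` descend
to a function on the curve, and its continuity in time makes that function continuous. -/
theorem iteratedIntegral_continuousOn_and_eq_of_eq (hab : a ≤ b)
    (hLip : ∀ i, ∃ K : ℝ≥0, LipschitzOnWith K (f i) (Icc a b))
    {V : Set (EuclideanSpace ℝ (Fin n))} (hT : IsArcTree V (imageCurve a b f)) (w : List (Fin n)) :
    ContinuousOn (iteratedIntegral a f w) (Icc a b) ∧
    ∀ s ∈ Icc a b, ∀ t ∈ Icc a b, pathOf f s = pathOf f t →
      iteratedIntegral a f w s = iteratedIntegral a f w t := by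
  obtain ⟨K, hK⟩ := lipschitzOnWith_pathOf hLip
  induction w with
  | nil => exact ⟨continuousOn_const, fun _ _ _ _ _ => rfl⟩
  | cons i w ih =>
    obtain ⟨hcont, heq⟩ := ih
    have hint : IntervalIntegrable (fun s => deriv (f i) s * iteratedIntegral a f w s)
        volume a b := by
      obtain ⟨K', hK'⟩ := hLip i
      rw [← uIcc_of_le hab] at hK' hcont
      exact hK'.absolutelyContinuousOnInterval.intervalIntegrable_deriv.mul_continuousOn hcont
    have hsub : ∀ {s t}, s ∈ Icc a b → t ∈ Icc a b →
        IntervalIntegrable (fun s => deriv (f i) s * iteratedIntegral a f w s) volume s t := by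
      intro s t hs ht
      refine hint.mono_set ?_
      rw [uIcc_of_le hab]
      exact uIcc_subset_Icc hs ht
    have ha : a ∈ Icc a b := left_mem_Icc.2 hab
    refine ⟨?_, ?_⟩
    · have := intervalIntegral.continuousOn_primitive_interval' hint left_mem_uIcc
      rwa [uIcc_of_le hab] at this
    · intro s hs t ht hst
      wlog hle : s ≤ t generalizing s t
      · exact (this t ht s hs hst.symm (le_of_not_ge hle)).symm
      -- The integral for `w` as a function on the curve; by `heq` the choice of preimage does not
      -- matter.
      set φ : EuclideanSpace ℝ (Fin n) → ℝ := fun x =>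
        iteratedIntegral a f w (Function.invFunOn (pathOf f) (Icc a b) x)
      have hφF : ∀ x ∈ Icc a b, φ (pathOf f x) = iteratedIntegral a f w x := by
        intro x hx
        have hx' : pathOf f x ∈ pathOf f '' Icc a b := ⟨x, hx, rfl⟩
        exact heq _ (Function.invFunOn_mem hx') x hx (Function.invFunOn_eq hx')
      have hφ : ContinuousOn φ (imageCurve a b f) :=
        continuousOn_image_of_isCompact isCompact_Icc hK.continuousOn hcont hφF
      have hst' : Icc s t ⊆ Icc a b := Icc_subset_Icc hs.1 ht.2
      have hzero := hT.integral_loop_eq_zero (lipschitzWith_coord i) hφ hle (hK.mono hst')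
        (fun x hx => ⟨x, hst' hx, rfl⟩) hst
      change ∫ x in a..s, _ = ∫ x in a..t, _
      rw [eq_comm, ← sub_eq_zero, intervalIntegral.integral_interval_sub_left (hsub ha ht)
        (hsub ha hs), ← hzero]
      refine intervalIntegral.integral_congr fun x hx => ?_
      rw [uIcc_of_le hle] at hx
      change deriv (f i) x * _ = _ * deriv (f i) x
      rw [hφF x (hst' hx), mul_comm]

theorem IsArcTree.iteratedIntegralsVanish (hab : a ≤ b)
    (hLip : ∀ i, ∃ K : ℝ≥0, LipschitzOnWith K (f i) (Icc a b))
    {V : Set (EuclideanSpace ℝ (Fin n))} (hT : IsArcTree V (imageCurve a b f))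
    (hclosed : pathOf f a = pathOf f b) : IteratedIntegralsVanish a b f := by
  intro w hw
  rw [← (iteratedIntegral_continuousOn_and_eq_of_eq hab hLip hT w).2 a (left_mem_Icc.2 hab) b
    (right_mem_Icc.2 hab) hclosed]
  cases w with
  | nil => exact absurd rfl hw
  | cons i w => exact intervalIntegral.integral_same

end IteratedIntegrals

/-! ### Contractibility and the fundamental group -/

theorem contractibleSpace_of_deformation {E : Type*} [TopologicalSpace E] {Γ Γ' : Set E}
    (hsub : Γ' ⊆ Γ) (hΓ' : ContractibleSpace Γ') (K : ℝ × E → E)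
    (hK : ContinuousOn K (Icc 0 1 ×ˢ Γ)) (hm : MapsTo K (Icc 0 1 ×ˢ Γ) Γ)
    (h0 : ∀ x ∈ Γ, K (0, x) = x) (h1 : ∀ x ∈ Γ, K (1, x) ∈ Γ') : ContractibleSpace Γ := by
  let H : C(I × Γ, Γ) := ⟨fun z => ⟨K (z.1, z.2), hm ⟨z.1.2, z.2.2⟩⟩,
    (hK.comp_continuous (by fun_prop) fun z => ⟨z.1.2, z.2.2⟩).subtype_mk _⟩
  let r : C(Γ, Γ') := ⟨fun x => ⟨K (1, x), h1 x x.2⟩,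
    (hK.comp_continuous (by fun_prop) fun x => ⟨by simp, x.2⟩).subtype_mk _⟩
  let ι : C(Γ', Γ) := ⟨inclusion hsub, continuous_inclusion hsub⟩
  -- The end map of the deformation factors through the nullhomotopic identity of `Γ'`.
  have hr : (ι.comp ((ContinuousMap.id Γ').comp r)).Nullhomotopic :=
    ((id_nullhomotopic Γ').comp_left r).comp_right ι
  obtain ⟨y, hy⟩ := hr
  refine (contractible_iff_id_nullhomotopic Γ).2 ⟨y, ContinuousMap.Homotopic.trans ⟨?_⟩ hy⟩
  exact { toContinuousMap := H
          map_zero_left := fun x => Subtype.ext (h0 x x.2)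
          map_one_left := fun x => rfl }

theorem continuousOn_invFunOn {X Y : Type*} [TopologicalSpace X] [T2Space X] [Nonempty X]
    [TopologicalSpace Y] [T2Space Y] {S : Set X} (hS : IsCompact S) {h : X → Y}
    (hc : ContinuousOn h S) (hinj : InjOn h S) :
    ContinuousOn (Function.invFunOn h S) (h '' S) :=
  continuousOn_image_of_isCompact hS hc continuousOn_id fun _ hx => hinj.leftInvOn_invFunOn hx

/-- The last arc slides into its root by `t ↦ (1 - s) * t` while `Γ` stays fixed. The two formulas
agree at the only common point `h 0`, and both pieces are closed. -/
theorem IsArcTree.contractibleSpace {E : Type*} [TopologicalSpace E] [T2Space E] {V Γ : Set E}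
    (hT : IsArcTree V Γ) : ContractibleSpace Γ := by
  induction hT with
  | point x => infer_instance
  | @attach V Γ h hT hc hinj hV hp ih =>
    set A := h '' Icc 0 1 with hA
    set g := Function.invFunOn h (Icc (0 : ℝ) 1)
    have hg : ContinuousOn g A := continuousOn_invFunOn isCompact_Icc hc hinj
    have hgh : ∀ t ∈ Icc (0 : ℝ) 1, g (h t) = t := fun t ht => hinj.leftInvOn_invFunOn ht
    have hmem : h 0 ∈ Γ ∩ A := hp ▸ mem_singleton _
    have hmul : ∀ s ∈ Icc (0 : ℝ) 1, ∀ t ∈ Icc (0 : ℝ) 1, (1 - s) * t ∈ Icc (0 : ℝ) 1 := by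
      intro s hs t ht
      exact ⟨mul_nonneg (by linarith [hs.2]) ht.1,
        mul_le_one₀ (by linarith [hs.1]) ht.1 ht.2⟩
    classical
    let K : ℝ × E → E := fun z => if z.2 ∈ Γ then z.2 else h ((1 - z.1) * g z.2)
    have hKΓ : ∀ s, ∀ x ∈ Γ, K (s, x) = x := fun s x hx => if_pos hx
    have hKA : ∀ s, ∀ t ∈ Icc (0 : ℝ) 1, K (s, h t) = h ((1 - s) * t) := by
      intro s t ht
      by_cases hx : h t ∈ Γ
      · have h' : h t ∈ Γ ∩ A := ⟨hx, t, ht, rfl⟩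
        rw [hp] at h'
        have : t = 0 := hinj ht (by simp) h'
        rw [hKΓ _ _ hx, this, mul_zero]
      · exact (if_neg hx).trans (by simp only [hgh t ht])
    refine contractibleSpace_of_deformation subset_union_left ih K ?_ ?_ ?_ ?_
    · rw [prod_union]
      refine ContinuousOn.union_of_isClosed ?_ ?_ (isClosed_Icc.prod hT.isCompact.isClosed)
        (isClosed_Icc.prod (isCompact_Icc.image_of_continuousOn hc).isClosed)
      · exact continuousOn_snd.congr fun z hz => hKΓ z.1 z.2 hz.2
      · have : ContinuousOn (fun z : ℝ × E => h ((1 - z.1) * g z.2)) (Icc 0 1 ×ˢ A) := by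
          refine hc.comp (ContinuousOn.mul (by fun_prop)
            (hg.comp continuousOn_snd fun z hz => hz.2)) ?_
          rintro ⟨s, x⟩ ⟨hs, t, ht, rfl⟩
          simp only [hgh t ht]
          exact hmul s hs t ht
        refine this.congr ?_
        rintro ⟨s, x⟩ ⟨hs, t, ht, rfl⟩
        simp only [hKA s t ht, hgh t ht]
    · rintro ⟨s, x⟩ ⟨hs, hx | ⟨t, ht, rfl⟩⟩
      · rw [hKΓ s x hx]; exact .inl hx
      · rw [hKA s t ht]; exact .inr ⟨_, hmul s hs t ht, rfl⟩
    · rintro x (hx | ⟨t, ht, rfl⟩)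
      · exact hKΓ 0 x hx
      · rw [hKA 0 t ht, sub_zero, one_mul]
    · rintro x (hx | ⟨t, ht, rfl⟩)
      · rw [hKΓ 1 x hx]; exact hx
      · rw [hKA 1 t ht, sub_self, zero_mul]; exact hmem.1

/-- A contractible space is simply connected, so any two elements of its fundamental group agree. -/
theorem isContractibleLoop_of_contractibleSpace {n : ℕ} {a b : ℝ} (hab : a ≤ b)
    {f : Fin n → ℝ → ℝ} (hc : ContinuousOn (pathOf f) (Icc a b))
    [ContractibleSpace (imageCurve a b f)] (hclosed : pathOf f a = pathOf f b) :
    IsContractibleLoop a b f := by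
  have hmem : ∀ t : I, a + (t : ℝ) * (b - a) ∈ Icc a b := fun t =>
    ⟨by nlinarith [t.2.1], by nlinarith [t.2.2]⟩
  refine ⟨⟨pathOf f a, a, left_mem_Icc.2 hab, rfl⟩,
    { toFun := fun t => ⟨pathOf f (a + t * (b - a)), _, hmem t, rfl⟩
      continuous_toFun := (hc.comp_continuous (by fun_prop) hmem).subtype_mk _
      source' := by simp
      target' := by simp [hclosed] }, fun t => rfl, Subsingleton.elim _ _⟩

/-! ### Realization of the curve as a finite tree -/

section Realization

theorem mem_graphRealization {V : Type*} [DecidableEq V] {G : SimpleGraph V} {x : V → ℝ} :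
    x ∈ graphRealization G ↔ (∃ v, x = Pi.single v 1) ∨
      ∃ u v, G.Adj u v ∧ x ∈ segment ℝ (Pi.single u (1 : ℝ)) (Pi.single v 1) := by
  simp [graphRealization, eq_comm (a := x)]

/-- The graph `G` with a new vertex `Fin.last k`, joined to `i` only. -/
def SimpleGraph.addLeaf {k : ℕ} (G : SimpleGraph (Fin k)) (i : Fin k) :
    SimpleGraph (Fin (k + 1)) :=
  G.map Fin.castSuccEmb ⊔ SimpleGraph.edge i.castSucc (Fin.last k)

theorem SimpleGraph.addLeaf_adj {k : ℕ} {G : SimpleGraph (Fin k)} {i : Fin k}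
    {u v : Fin (k + 1)} : (G.addLeaf i).Adj u v ↔
      (∃ u' v', G.Adj u' v' ∧ u'.castSucc = u ∧ v'.castSucc = v) ∨
      (u = i.castSucc ∧ v = Fin.last k ∨ u = Fin.last k ∧ v = i.castSucc) := by
  have h1 : i.castSucc ≠ Fin.last k := (Fin.castSucc_lt_last i).ne
  rw [addLeaf, SimpleGraph.sup_adj, SimpleGraph.map_adj, SimpleGraph.edge_adj]
  simp only [Fin.coe_castSuccEmb]
  grind

theorem SimpleGraph.IsTree.addLeaf {k : ℕ} {G : SimpleGraph (Fin k)} (hG : G.IsTree) (i : Fin k) :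
    (G.addLeaf i).IsTree := by
  have hconn : (G.addLeaf i).Connected := by
    refine SimpleGraph.connected_iff_exists_forall_reachable _ |>.2 ⟨i.castSucc, fun v => ?_⟩
    induction v using Fin.lastCases with
    | last => exact (SimpleGraph.addLeaf_adj.2 (.inr (.inl ⟨rfl, rfl⟩))).reachable
    | cast j =>
      let φ : G →g G.addLeaf i :=
        ⟨Fin.castSucc, fun {u v} h => SimpleGraph.addLeaf_adj.2 (.inl ⟨u, v, h, rfl, rfl⟩)⟩
      exact (hG.connected.preconnected i j).map φ
  rw [SimpleGraph.isTree_iff_connected_and_card]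
  -- Connectedness bounds the number of edges from below; for the upper bound, at most one edge is
  -- added together with one vertex.
  refine ⟨hconn, le_antisymm ?_ hconn.card_vert_le_card_edgeSet_add_one⟩
  have h1 := (SimpleGraph.isTree_iff_connected_and_card.1 hG).2
  have h2 : (G.addLeaf i).edgeSet ⊆
      insert s(i.castSucc, Fin.last k) (Sym2.map Fin.castSucc '' G.edgeSet) := by
    intro e
    induction e using Sym2.ind with
    | _ u v =>
      rw [SimpleGraph.mem_edgeSet, SimpleGraph.addLeaf_adj]
      rintro (⟨u', v', h, rfl, rfl⟩ | ⟨rfl, rfl⟩ | ⟨rfl, rfl⟩)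
      · exact .inr ⟨s(u', v'), h, rfl⟩
      · exact .inl rfl
      · exact .inl Sym2.eq_swap
  have h3 := Set.ncard_le_ncard h2 (Set.toFinite _)
  have h4 := Set.ncard_insert_le s(i.castSucc, Fin.last k) (Sym2.map Fin.castSucc '' G.edgeSet)
  have h5 := Set.ncard_image_le (f := Sym2.map Fin.castSucc) (Set.toFinite G.edgeSet)
  simp only [Nat.card_coe_set_eq, Nat.card_fin] at h1 ⊢
  omega

/-- Extension of a vector by a last coordinate `0`. -/
def snocZero (k : ℕ) : (Fin k → ℝ) →ₗ[ℝ] (Fin (k + 1) → ℝ) where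
  toFun x := Fin.snoc x 0
  map_add' x y := by
    ext j
    induction j using Fin.lastCases <;> simp
  map_smul' c x := by
    ext j
    induction j using Fin.lastCases <;> simp

theorem snocZero_last {k : ℕ} (x : Fin k → ℝ) : snocZero k x (Fin.last k) = 0 := by
  simp [snocZero]

theorem snocZero_castSucc {k : ℕ} (x : Fin k → ℝ) (j : Fin k) :
    snocZero k x j.castSucc = x j := by
  simp [snocZero]

theorem snocZero_injective (k : ℕ) : Function.Injective (snocZero k) := by
  intro x y hxy
  ext j
  rw [← snocZero_castSucc x, hxy, snocZero_castSucc]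

theorem snocZero_single {k : ℕ} (j : Fin k) :
    snocZero k (Pi.single j 1) = Pi.single j.castSucc 1 := by
  ext l
  induction l using Fin.lastCases with
  | last => rw [snocZero_last, Pi.single_eq_of_ne (Fin.castSucc_lt_last j).ne']
  | cast l => simp [snocZero_castSucc, Pi.single_apply]

theorem graphRealization_addLeaf {k : ℕ} (G : SimpleGraph (Fin k)) (i : Fin k) :
    graphRealization (G.addLeaf i) = snocZero k '' graphRealization G ∪
      segment ℝ (Pi.single i.castSucc (1 : ℝ)) (Pi.single (Fin.last k) 1) := by
  have himg : ∀ u v : Fin k, snocZero k '' segment ℝ (Pi.single u 1) (Pi.single v 1)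
      = segment ℝ (Pi.single u.castSucc (1 : ℝ)) (Pi.single v.castSucc 1) := by
    intro u v
    rw [← snocZero_single, ← snocZero_single]
    exact image_segment ℝ (snocZero k).toAffineMap _ _
  ext x
  rw [mem_graphRealization, mem_union]
  constructor
  · rintro (⟨v, rfl⟩ | ⟨u, v, huv, hx⟩)
    · induction v using Fin.lastCases with
      | last => exact .inr (right_mem_segment _ _ _)
      | cast j => exact .inl ⟨_, mem_graphRealization.2 (.inl ⟨j, rfl⟩), snocZero_single j⟩
    · rw [SimpleGraph.addLeaf_adj] at huv
      obtain ⟨u', v', h, rfl, rfl⟩ | ⟨rfl, rfl⟩ | ⟨rfl, rfl⟩ := huv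
      · rw [← himg] at hx
        obtain ⟨y, hy, rfl⟩ := hx
        exact .inl ⟨y, mem_graphRealization.2 (.inr ⟨u', v', h, hy⟩), rfl⟩
      · exact .inr hx
      · exact .inr (by rwa [segment_symm])
  · rintro (⟨y, hy, rfl⟩ | hx)
    · obtain ⟨v, rfl⟩ | ⟨u, v, huv, hy⟩ := mem_graphRealization.1 hy
      · exact .inl ⟨v.castSucc, snocZero_single v⟩
      · refine .inr ⟨u.castSucc, v.castSucc,
          SimpleGraph.addLeaf_adj.2 (.inl ⟨u, v, huv, rfl, rfl⟩), ?_⟩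
        rw [← himg]
        exact ⟨y, hy, rfl⟩
    · exact .inr ⟨_, _, SimpleGraph.addLeaf_adj.2 (.inr (.inl ⟨rfl, rfl⟩)), hx⟩

end Realization

/-- The new arc is mapped onto the new edge so that its parameter becomes the last coordinate, which
is zero on the old part; this gives injectivity. The clause on `V` ensures that the next arc is
attached at a vertex of the graph. -/
theorem IsArcTree.exists_graphRealization {E : Type*} [TopologicalSpace E] [T2Space E]
    {V Γ : Set E} (hT : IsArcTree V Γ) :
    ∃ (k : ℕ) (G : SimpleGraph (Fin k)), G.IsTree ∧ ∃ Ψ : E → Fin k → ℝ,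
      ContinuousOn Ψ Γ ∧ InjOn Ψ Γ ∧ Ψ '' Γ = graphRealization G ∧
      ∀ v ∈ V, ∃ i, Ψ v = Pi.single i 1 := by
  induction hT with
  | point x =>
    refine ⟨1, ⊥, .of_subsingleton, fun _ => Pi.single 0 1, continuousOn_const,
      injOn_singleton _ _, ?_, fun _ _ => ⟨0, rfl⟩⟩
    ext y
    simp [mem_graphRealization]
  | @attach V Γ h hT hc hinj hV hp ih =>
    obtain ⟨k, G, hG, Ψ, hΨc, hΨi, hΨG, hΨV⟩ := ih
    obtain ⟨i, hi⟩ := hΨV _ hV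
    set A := h '' Icc 0 1 with hA
    set g := Function.invFunOn h (Icc (0 : ℝ) 1)
    have hg : ContinuousOn g A := continuousOn_invFunOn isCompact_Icc hc hinj
    have hgh : ∀ t ∈ Icc (0 : ℝ) 1, g (h t) = t := fun t ht => hinj.leftInvOn_invFunOn ht
    have hmem : h 0 ∈ Γ ∩ A := hp ▸ mem_singleton _
    classical
    let q : ℝ → Fin (k + 1) → ℝ := fun t =>
      (1 - t) • Pi.single i.castSucc 1 + t • Pi.single (Fin.last k) 1
    have hqlast : ∀ t, q t (Fin.last k) = t := by
      intro t
      simp [q, (Fin.castSucc_lt_last i).ne']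
    let Ψ' : E → Fin (k + 1) → ℝ := fun x => if x ∈ Γ then snocZero k (Ψ x) else q (g x)
    have hΨΓ : ∀ x ∈ Γ, Ψ' x = snocZero k (Ψ x) := fun x hx => if_pos hx
    have hΨA : ∀ t ∈ Icc (0 : ℝ) 1, Ψ' (h t) = q t := by
      intro t ht
      by_cases hx : h t ∈ Γ
      · have h' : h t ∈ Γ ∩ A := ⟨hx, t, ht, rfl⟩
        rw [hp] at h'
        have : t = 0 := hinj ht (by simp) h'
        rw [hΨΓ _ hx, this, hi, snocZero_single]
        simp [q]
      · exact (if_neg hx).trans (by rw [hgh t ht])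
    refine ⟨k + 1, G.addLeaf i, hG.addLeaf i, Ψ', ?_, ?_, ?_, ?_⟩
    · refine ContinuousOn.union_of_isClosed ?_ ?_ hT.isCompact.isClosed
        (isCompact_Icc.image_of_continuousOn hc).isClosed
      · exact ((snocZero k).continuous_of_finiteDimensional.comp_continuousOn hΨc).congr hΨΓ
      · have hq : Continuous q := by fun_prop
        refine (hq.comp_continuousOn hg).congr ?_
        rintro _ ⟨t, ht, rfl⟩
        simp only [hΨA t ht, Function.comp, hgh t ht]
    · have hΓΓ : ∀ x ∈ Γ, ∀ y ∈ Γ, Ψ' x = Ψ' y → x = y := by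
        intro x hx y hy hxy
        rw [hΨΓ x hx, hΨΓ y hy] at hxy
        exact hΨi hx hy (snocZero_injective k hxy)
      have hΓA : ∀ x ∈ Γ, ∀ t ∈ Icc (0 : ℝ) 1, Ψ' x = Ψ' (h t) → x = h t := by
        intro x hx t ht hxy
        -- Comparing last coordinates forces `t = 0`, so `h t` is the root, which lies in `Γ`.
        have h' := congrFun hxy (Fin.last k)
        rw [hΨA t ht, hqlast, hΨΓ x hx, snocZero_last] at h'
        exact hΓΓ x hx _ (h' ▸ hmem.1) hxy
      rintro x (hx | ⟨s, hs, rfl⟩) y (hy | ⟨t, ht, rfl⟩) hxy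
      · exact hΓΓ x hx y hy hxy
      · exact hΓA x hx t ht hxy
      · exact (hΓA y hy s hs hxy.symm).symm
      · rw [hΨA s hs, hΨA t ht] at hxy
        have h' := congrFun hxy (Fin.last k)
        rw [hqlast, hqlast] at h'
        rw [h']
    · rw [image_union, graphRealization_addLeaf, ← hΨG, image_congr hΨΓ]
      refine congrArg₂ _ (image_image (snocZero k) Ψ Γ).symm ?_
      rw [hA, image_image, segment_eq_image]
      exact image_congr hΨA
    · rintro v (rfl | hv)
      · refine ⟨Fin.last k, ?_⟩
        rw [hΨA 1 (by simp)]
        simp [q]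
      · obtain ⟨j, hj⟩ := hΨV v hv
        exact ⟨j.castSucc, by rw [hΨΓ v (hT.subset hv), hj, snocZero_single]⟩

theorem IsArcTree.treeCompositionCondition {n : ℕ} {a b : ℝ} {f : Fin n → ℝ → ℝ}
    {V : Set (EuclideanSpace ℝ (Fin n))} (hT : IsArcTree V (imageCurve a b f))
    (hc : ContinuousOn (pathOf f) (Icc a b)) (hclosed : pathOf f a = pathOf f b) :
    TreeCompositionCondition a b f := by
  obtain ⟨k, G, hG, Ψ, hΨc, hΨi, hΨG, -⟩ := hT.exists_graphRealization
  have hmaps : MapsTo (pathOf f) (Icc a b) (imageCurve a b f) := mapsTo_image _ _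
  refine ⟨k, G, hG, Ψ ∘ pathOf f, Function.invFunOn Ψ (imageCurve a b f),
    hΨc.comp hc hmaps, ?_, ?_, ?_, congrArg Ψ hclosed, fun t ht => ?_⟩
  · exact hΨG ▸ (mapsTo_image Ψ _).comp hmaps
  · exact hΨG ▸ continuousOn_invFunOn hT.isCompact hΨc hΨi
  · rw [← hΨG]
    intro x hx
    exact Function.invFunOn_mem hx
  · exact (hΨi.leftInvOn_invFunOn (hmaps ht)).symm

/-! ### Concatenation of arcs and simple loops -/

section Concatenation

variable {E : Type*} {γ₁ γ₂ : ℝ → E} {S : Set ℝ}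

/-- Concatenation of two paths parametrized by `[0, 1]`, parametrized by `[0, 2]`. -/
noncomputable def concatPath (γ₁ γ₂ : ℝ → E) (t : ℝ) : E := if t ≤ 1 then γ₁ t else γ₂ (t - 1)

theorem concatPath_of_le {t : ℝ} (ht : t ≤ 1) : concatPath γ₁ γ₂ t = γ₁ t := if_pos ht

theorem concatPath_of_ge (h : γ₁ 1 = γ₂ 0) {t : ℝ} (ht : 1 ≤ t) :
    concatPath γ₁ γ₂ t = γ₂ (t - 1) := by
  rcases ht.eq_or_lt with rfl | ht
  · rw [concatPath_of_le le_rfl, h, sub_self]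
  · exact if_neg ht.not_ge

theorem continuousOn_concatPath [TopologicalSpace E] (h₁ : ContinuousOn γ₁ (Icc 0 1))
    (h₂ : ContinuousOn γ₂ (Icc 0 1)) (h : γ₁ 1 = γ₂ 0) :
    ContinuousOn (concatPath γ₁ γ₂) (Icc 0 2) := by
  rw [← Icc_union_Icc_eq_Icc (zero_le_one (α := ℝ)) one_le_two]
  refine ContinuousOn.union_of_isClosed ?_ ?_ isClosed_Icc isClosed_Icc
  · exact h₁.congr fun t ht => concatPath_of_le ht.2
  · refine (h₂.comp (f := fun t : ℝ => t - 1) (by fun_prop) ?_).congr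
      fun t ht => concatPath_of_ge h ht.1
    exact fun t ht => ⟨by linarith [ht.1], by linarith [ht.2]⟩

theorem mapsTo_concatPath {Γ : Set E} (h₁ : MapsTo γ₁ (Icc 0 1) Γ) (h₂ : MapsTo γ₂ (Icc 0 1) Γ)
    (h : γ₁ 1 = γ₂ 0) : MapsTo (concatPath γ₁ γ₂) (Icc 0 2) Γ := by
  intro t ht
  rcases le_total t 1 with ht1 | ht1
  · rw [concatPath_of_le ht1]
    exact h₁ ⟨ht.1, ht1⟩
  · rw [concatPath_of_ge h ht1]
    exact h₂ ⟨by linarith, by linarith [ht.2]⟩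

/-- The set `S` is `Icc 0 2` when the result is to be an arc and `Ico 0 2` when it is to be a simple
loop. -/
theorem injOn_concatPath (h₁ : InjOn γ₁ (Icc 0 1)) (h₂ : InjOn γ₂ (Icc 0 1)) (h : γ₁ 1 = γ₂ 0)
    (hS : S ⊆ Icc 0 2) (hne : ∀ x ∈ Icc (0 : ℝ) 1, ∀ y ∈ S, 1 < y → γ₁ x ≠ γ₂ (y - 1)) :
    InjOn (concatPath γ₁ γ₂) S := by
  have key : ∀ x ∈ S, ∀ y ∈ S, x ≤ y → concatPath γ₁ γ₂ x = concatPath γ₁ γ₂ y → x = y := by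
    intro x hx y hy hxy he
    have hx' := hS hx
    have hy' := hS hy
    rcases le_or_gt y 1 with hy1 | hy1
    · rw [concatPath_of_le hy1, concatPath_of_le (hxy.trans hy1)] at he
      exact h₁ ⟨hx'.1, hxy.trans hy1⟩ ⟨hy'.1, hy1⟩ he
    · rw [concatPath_of_ge h hy1.le] at he
      rcases le_total x 1 with hx1 | hx1
      · rw [concatPath_of_le hx1] at he
        exact absurd he (hne x ⟨hx'.1, hx1⟩ y hy hy1)
      · rw [concatPath_of_ge h hx1] at he
        have := h₂ ⟨by linarith, by linarith [hx'.2]⟩ ⟨by linarith, by linarith [hy'.2]⟩ he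
        linarith
  intro x hx y hy he
  rcases le_total x y with hxy | hxy
  · exact key x hx y hy hxy he
  · exact (key y hy x hx hxy he.symm).symm

theorem mapsTo_one_sub : MapsTo (fun t : ℝ => 1 - t) (Icc 0 1) (Icc 0 1) :=
  fun t ht => ⟨by linarith [ht.2], by linarith [ht.1]⟩

theorem injOn_one_sub_comp {γ : ℝ → E} (hγ : InjOn γ (Icc 0 1)) :
    InjOn (fun t => γ (1 - t)) (Icc 0 1) :=
  hγ.comp (fun _ _ _ _ h => sub_right_injective h) mapsTo_one_sub

end Concatenation

section Arcs

variable {E : Type*} [TopologicalSpace E] {Γ Γ' : Set E} {p q r : E}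

/-- The points `p` and `q` are the endpoints of an arc in `Γ`. -/
def JoinedByArc (Γ : Set E) (p q : E) : Prop :=
  ∃ γ : ℝ → E, ContinuousOn γ (Icc 0 1) ∧ InjOn γ (Icc 0 1) ∧ MapsTo γ (Icc 0 1) Γ ∧
    γ 0 = p ∧ γ 1 = q

theorem continuousOn_one_sub_comp {γ : ℝ → E} (hγ : ContinuousOn γ (Icc 0 1)) :
    ContinuousOn (fun t => γ (1 - t)) (Icc 0 1) :=
  hγ.comp (by fun_prop) mapsTo_one_sub

theorem JoinedByArc.symm (h : JoinedByArc Γ p q) : JoinedByArc Γ q p := by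
  obtain ⟨γ, hc, hi, hm, h0, h1⟩ := h
  exact ⟨fun t => γ (1 - t), continuousOn_one_sub_comp hc, injOn_one_sub_comp hi,
    hm.comp mapsTo_one_sub, by simpa using h1, by simpa using h0⟩

theorem JoinedByArc.mono (h : JoinedByArc Γ p q) (hsub : Γ ⊆ Γ') : JoinedByArc Γ' p q := by
  obtain ⟨γ, hc, hi, hm, h01⟩ := h
  exact ⟨γ, hc, hi, hm.mono_right hsub, h01⟩

theorem JoinedByArc.trans (h : JoinedByArc Γ p q) (h' : JoinedByArc Γ' q r) (hq : Γ ∩ Γ' = {q}) :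
    JoinedByArc (Γ ∪ Γ') p r := by
  obtain ⟨γ₁, hc₁, hi₁, hm₁, rfl, rfl⟩ := h
  obtain ⟨γ₂, hc₂, hi₂, hm₂, h0, rfl⟩ := h'
  have hinj : InjOn (concatPath γ₁ γ₂) (Icc 0 2) := by
    refine injOn_concatPath hi₁ hi₂ h0.symm Subset.rfl fun x hx y hy hy1 he => ?_
    have hy' : y - 1 ∈ Icc (0 : ℝ) 1 := ⟨by linarith, by linarith [hy.2]⟩
    have hmem : γ₂ (y - 1) ∈ Γ ∩ Γ' := ⟨he ▸ hm₁ hx, hm₂ hy'⟩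
    rw [hq, ← h0] at hmem
    have := hi₂ hy' (by simp) hmem
    linarith
  have hmaps : MapsTo (fun t : ℝ => 2 * t) (Icc 0 1) (Icc 0 2) :=
    fun t ht => ⟨by linarith [ht.1], by linarith [ht.2]⟩
  refine ⟨fun t => concatPath γ₁ γ₂ (2 * t),
    (continuousOn_concatPath hc₁ hc₂ h0.symm).comp (by fun_prop) hmaps,
    hinj.comp (fun x _ y _ h => by simpa using h) hmaps,
    (mapsTo_concatPath (hm₁.mono_right subset_union_left) (hm₂.mono_right subset_union_right)
      h0.symm).comp hmaps, ?_, ?_⟩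
  · simp [concatPath_of_le]
  · simp only [mul_one]
    rw [concatPath_of_ge h0.symm one_le_two]
    norm_num

theorem exists_reorient {k : ℝ → E} (hc : ContinuousOn k (Icc 0 1)) (hi : InjOn k (Icc 0 1)) {p : E}
    (hp : p = k 0 ∨ p = k 1) : ∃ k' : ℝ → E, ContinuousOn k' (Icc 0 1) ∧ InjOn k' (Icc 0 1) ∧
      k' '' Icc 0 1 = k '' Icc 0 1 ∧ k' 0 = p ∧ ({k' 0, k' 1} : Set E) = {k 0, k 1} := by
  rcases hp with rfl | rfl
  · exact ⟨k, hc, hi, rfl, rfl, rfl⟩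
  · refine ⟨fun t => k (1 - t), continuousOn_one_sub_comp hc, injOn_one_sub_comp hi, ?_, by simp, ?_⟩
    · rw [← image_image k (fun t : ℝ => 1 - t), image_const_sub_Icc, sub_self, sub_zero]
    · simp [pair_comm]

/-- A new vertex is reached through the root of its arc; the concatenation is simple because the arc
meets the old part only there. -/
theorem IsArcTree.joinedByArc {V Γ : Set E} (hT : IsArcTree V Γ) :
    ∀ p ∈ V, ∀ q ∈ V, p ≠ q → JoinedByArc Γ p q := by
  induction hT with
  | point x =>
    rintro p rfl q rfl h
    exact absurd rfl h
  | @attach V Γ h hT hc hinj hV hp ih =>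
    have harc : JoinedByArc (h '' Icc 0 1) (h 0) (h 1) :=
      ⟨h, hc, hinj, mapsTo_image _ _, rfl, rfl⟩
    have haux : ∀ p ∈ V, JoinedByArc (Γ ∪ h '' Icc 0 1) p (h 1) := by
      intro p hpV
      by_cases h0 : p = h 0
      · exact h0 ▸ harc.mono subset_union_right
      · exact (ih p hpV _ hV h0).trans harc hp
    rintro p (rfl | hpV) q (rfl | hqV) hne
    · exact absurd rfl hne
    · exact (haux q hqV).symm
    · exact haux p hpV
    · exact (ih p hpV q hqV hne).mono subset_union_left

/-- The loop descends to a continuous injection of `AddCircle 2`, which by compactness is an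
embedding. -/
theorem ContainsNoCircle.false_of_simple_loop [T2Space E] (hΓ : ContainsNoCircle Γ) {c : ℝ → E}
    (hc : ContinuousOn c (Icc 0 2)) (hinj : InjOn c (Ico 0 2)) (hm : MapsTo c (Icc 0 2) Γ)
    (hloop : c 0 = c 2) : False := by
  have : Fact ((0 : ℝ) < 2) := ⟨two_pos⟩
  let F : AddCircle (2 : ℝ) → E := AddCircle.liftIco 2 0 c
  have hFc : Continuous F := AddCircle.liftIco_zero_continuous hloop hc
  have hIco : Ico (0 : ℝ) (0 + 2) = Ico 0 2 := by rw [zero_add]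
  have hFi : Function.Injective F := by
    refine Function.Injective.comp ?_ (AddCircle.equivIco (2 : ℝ) 0).injective
    rintro ⟨x, hx⟩ ⟨y, hy⟩ h
    exact Subtype.ext (hinj (hIco ▸ hx) (hIco ▸ hy) h)
  have hrange : range F ⊆ Γ := by
    rintro _ ⟨z, rfl⟩
    have hz := ((AddCircle.equivIco (2 : ℝ) 0) z).2
    have hz' : ((AddCircle.equivIco (2 : ℝ) 0) z : ℝ) ∈ Ico (0 : ℝ) 2 := hIco.le hz
    exact hm (Ico_subset_Icc_self hz')
  exact hΓ _ hrange ⟨(hFc.isClosedEmbedding hFi).isEmbedding.toHomeomorph.symm.trans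
    (AddCircle.homeomorphCircle two_ne_zero)⟩

theorem ContainsNoCircle.false_of_joinedByArc [T2Space E] (hΓ : ContainsNoCircle Γ)
    {A B : Set E} (hA : A ⊆ Γ) (hB : B ⊆ Γ) (hjA : JoinedByArc A p q) (hjB : JoinedByArc B q p)
    (hAB : A ∩ B ⊆ {p, q}) : False := by
  obtain ⟨γ₁, hc₁, hi₁, hm₁, rfl, rfl⟩ := hjA
  obtain ⟨γ₂, hc₂, hi₂, hm₂, h0, h1⟩ := hjB
  refine hΓ.false_of_simple_loop (continuousOn_concatPath hc₁ hc₂ h0.symm) ?_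
    (mapsTo_concatPath (hm₁.mono_right hA) (hm₂.mono_right hB) h0.symm) ?_
  · refine injOn_concatPath hi₁ hi₂ h0.symm Ico_subset_Icc_self fun x hx y hy hy1 he => ?_
    have hy' : y - 1 ∈ Icc (0 : ℝ) 1 := ⟨by linarith, by linarith [hy.2]⟩
    have hmem : γ₂ (y - 1) ∈ A ∩ B := ⟨he ▸ hm₁ hx, hm₂ hy'⟩
    rcases hAB hmem with h | h
    -- A meeting at `p` forces `y = 2`, excluded by the half-open interval; one at `q` forces `y =
    -- 1`, excluded by `1 < y`.
    · have := hi₂ hy' (by simp) (h.trans h1.symm)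
      linarith [hy.2]
    · have := hi₂ hy' (by simp) (h.trans h0.symm)
      linarith
  · rw [concatPath_of_le zero_le_one, concatPath_of_ge h0.symm one_le_two, ← h1]
    norm_num

end Arcs

/-! ### Ordering the arcs of a circle-free triangulation -/

section Triangulation

variable {E : Type*} [TopologicalSpace E] [T2Space E] {m : ℕ} {h : Fin m → ℝ → E}

/-- The union of the arcs with index in `J` is an arc tree, and their endpoints are vertices. -/
def SpansArcTree (h : Fin m → ℝ → E) (J : Finset (Fin m)) : Prop :=
  ∃ V, IsArcTree V (⋃ i ∈ J, h i '' Icc 0 1) ∧ ∀ i ∈ J, h i 0 ∈ V ∧ h i 1 ∈ V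

/-- Connectedness provides an unused arc touching the current tree, necessarily at an endpoint that
is a vertex. Were its other endpoint also in the tree, an arc of the tree between the two endpoints
would close it up to a circle. -/
theorem SpansArcTree.exists_insert (hc : ∀ i, ContinuousOn (h i) (Icc 0 1))
    (hi : ∀ i, InjOn (h i) (Icc 0 1))
    (hinter : ∀ i j, i ≠ j → h i '' Icc 0 1 ∩ h j '' Icc 0 1 = ∅ ∨
      ∃ p ∈ ({h i 0, h i 1} ∩ {h j 0, h j 1} : Set E), h i '' Icc 0 1 ∩ h j '' Icc 0 1 = {p})
    (hconn : IsPreconnected (⋃ i, h i '' Icc 0 1))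
    (hcircle : ContainsNoCircle (⋃ i, h i '' Icc 0 1)) {J : Finset (Fin m)}
    (hJ : SpansArcTree h J) (hne : J.Nonempty) (hJu : J ≠ Finset.univ) :
    ∃ j ∉ J, SpansArcTree h (insert j J) := by
  obtain ⟨V, hT, hV⟩ := hJ
  set Γ := ⋃ i ∈ J, h i '' Icc 0 1 with hΓ
  have hclosed : ∀ i, IsClosed (h i '' Icc 0 1) := fun i =>
    (isCompact_Icc.image_of_continuousOn (hc i)).isClosed
  have hend : ∀ i j, i ∈ J → j ∉ J → ∀ x ∈ h i '' Icc 0 1 ∩ h j '' Icc 0 1,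
      x ∈ V ∧ x ∈ ({h j 0, h j 1} : Set E) := by
    intro i j hiJ hjJ x hx
    rcases hinter i j (fun hij => hjJ (hij ▸ hiJ)) with he | ⟨p, hp, he⟩
    · rw [he] at hx
      exact hx.elim
    · rw [he] at hx
      obtain rfl : x = p := hx
      refine ⟨?_, hp.2⟩
      rcases hp.1 with h' | h'
      · exact h' ▸ (hV i hiJ).1
      · exact h' ▸ (hV i hiJ).2
  obtain ⟨i₀, hi₀⟩ := hne
  obtain ⟨j₀, hj₀⟩ : ∃ j, j ∉ J := by
    by_contra! hall
    exact hJu (Finset.eq_univ_of_forall hall)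
  have hstart : ∀ i, h i 0 ∈ h i '' Icc 0 1 := fun i => ⟨0, by simp, rfl⟩
  -- The used and the unused arcs form two nonempty closed sets covering a connected set, so they
  -- meet.
  obtain ⟨x, -, hxΓ, hxΓ'⟩ := isPreconnected_closed_iff.1 hconn Γ (⋃ j ∈ {j | j ∉ J}, h j '' Icc 0 1)
    hT.isCompact.isClosed ((Set.toFinite _).isClosed_biUnion fun j _ => hclosed j)
    (by
      intro x hx
      obtain ⟨i, hx⟩ := mem_iUnion.1 hx
      by_cases hiJ : i ∈ J
      · exact .inl (mem_biUnion (s := (J : Set (Fin m))) hiJ hx)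
      · exact .inr (mem_biUnion (s := {j | j ∉ J}) hiJ hx))
    ⟨h i₀ 0, mem_iUnion.2 ⟨i₀, hstart i₀⟩, mem_biUnion (s := (J : Set (Fin m))) hi₀ (hstart i₀)⟩
    ⟨h j₀ 0, mem_iUnion.2 ⟨j₀, hstart j₀⟩, mem_biUnion (s := {j | j ∉ J}) hj₀ (hstart j₀)⟩
  obtain ⟨j, hjJ, hxj⟩ := mem_iUnion₂.1 hxΓ'
  have hend' : ∀ y ∈ Γ, y ∈ h j '' Icc 0 1 → y ∈ V ∧ y ∈ ({h j 0, h j 1} : Set E) := by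
    intro y hy hyj
    obtain ⟨i, hiJ, hyi⟩ := mem_iUnion₂.1 hy
    exact hend i j hiJ hjJ y ⟨hyi, hyj⟩
  -- The arc is reversed if necessary, so that the contact point is its root at parameter `0`.
  obtain ⟨k, hkc, hki, hkA, rfl, hk01⟩ := exists_reorient (hc j) (hi j) (hend' x hxΓ hxj).2
  rw [← hkA, ← hk01] at hend'
  have hk0 : k 0 ∈ V := (hend' _ hxΓ ⟨0, by simp, rfl⟩).1
  refine ⟨j, hjJ, ?_⟩
  have hk1 : k 1 ∉ Γ := by
    intro hk1
    have hk1V : k 1 ∈ V := (hend' _ hk1 ⟨1, by simp, rfl⟩).1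
    have h01 : k 1 ≠ k 0 := fun he => one_ne_zero (hki (by simp) (by simp) he)
    refine hcircle.false_of_joinedByArc (A := Γ) (B := k '' Icc 0 1) (iUnion₂_subset fun i _ =>
      subset_iUnion (fun i => h i '' Icc 0 1) i) ?_ (hT.joinedByArc _ hk1V _ hk0 h01)
      ⟨k, hkc, hki, mapsTo_image _ _, rfl, rfl⟩ ?_
    · rw [hkA]
      exact subset_iUnion (fun i => h i '' Icc 0 1) j
    · rintro y ⟨hy, hyk⟩
      exact pair_comm (k 0) (k 1) ▸ (hend' y hy hyk).2
  have hinter' : Γ ∩ k '' Icc 0 1 = {k 0} := by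
    refine Subset.antisymm ?_ (singleton_subset_iff.2 ⟨hxΓ, 0, by simp, rfl⟩)
    rintro y ⟨hy, hyk⟩
    rcases (hend' y hy hyk).2 with h' | h'
    · exact h'
    · exact absurd (h' ▸ hy) hk1
  refine ⟨insert (k 1) V, ?_, ?_⟩
  · have := hT.attach k hkc hki hk0 hinter'
    rwa [hkA, union_comm, hΓ, ← Finset.set_biUnion_insert j J fun i => h i '' Icc 0 1] at this
  · have hsub : ({k 0, k 1} : Set E) ⊆ insert (k 1) V := by
      rintro y (rfl | rfl)
      · exact .inr hk0
      · exact .inl rfl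
    intro i hiJ
    rcases Finset.mem_insert.1 hiJ with rfl | hiJ
    · rw [hk01] at hsub
      exact ⟨hsub (by simp), hsub (by simp)⟩
    · exact ⟨.inr (hV i hiJ).1, .inr (hV i hiJ).2⟩

theorem exists_isArcTree_iUnion (hc : ∀ i, ContinuousOn (h i) (Icc 0 1))
    (hi : ∀ i, InjOn (h i) (Icc 0 1))
    (hinter : ∀ i j, i ≠ j → h i '' Icc 0 1 ∩ h j '' Icc 0 1 = ∅ ∨
      ∃ p ∈ ({h i 0, h i 1} ∩ {h j 0, h j 1} : Set E), h i '' Icc 0 1 ∩ h j '' Icc 0 1 = {p})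
    (hconn : IsConnected (⋃ i, h i '' Icc 0 1))
    (hcircle : ContainsNoCircle (⋃ i, h i '' Icc 0 1)) :
    ∃ V, IsArcTree V (⋃ i, h i '' Icc 0 1) := by
  obtain ⟨x, hx⟩ := hconn.nonempty
  obtain ⟨i₀, -⟩ := mem_iUnion.1 hx
  have key : ∀ l, l + 1 ≤ m → ∃ J : Finset (Fin m), J.card = l + 1 ∧ SpansArcTree h J := by
    intro l
    induction l with
    | zero =>
      intro _
      have hmem : h i₀ 0 ∈ h i₀ '' Icc 0 1 := ⟨0, by simp, rfl⟩
      -- The first arc is attached to the one-point tree at its own starting point.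
      have := (IsArcTree.point (h i₀ 0)).attach (h i₀) (hc i₀) (hi i₀) rfl
        (inter_eq_left.2 (singleton_subset_iff.2 hmem))
      rw [union_eq_right.2 (singleton_subset_iff.2 hmem)] at this
      exact ⟨{i₀}, by simp, _, by simpa using this, by simp⟩
    | succ l ih =>
      intro hl
      obtain ⟨J, hJ, hJT⟩ := ih (by omega)
      obtain ⟨j, hj, hjT⟩ := hJT.exists_insert hc hi hinter hconn.isPreconnected hcircle
        (Finset.card_pos.1 (by omega)) (by
          rintro rfl
          rw [Finset.card_univ, Fintype.card_fin] at hJ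
          omega)
      exact ⟨insert j J, by rw [Finset.card_insert_of_notMem hj, hJ], hjT⟩
  have hm := i₀.pos
  obtain ⟨J, hJ, V, hT, -⟩ := key (m - 1) (by omega)
  have hJu : J = Finset.univ := by
    rw [← Finset.card_eq_iff_eq_univ, Fintype.card_fin]
    omega
  exact ⟨V, by simpa [hJu] using hT⟩

end Triangulation

/-! ### Conclusion -/

theorem IsLipschitzTriangulable.exists_isArcTree {E : Type*} [MetricSpace E] {Γ : Set E}
    (hΓ : IsLipschitzTriangulable Γ) (hconn : IsConnected Γ) (hcircle : ContainsNoCircle Γ) :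
    ∃ V, IsArcTree V Γ := by
  obtain ⟨m, h, harc, rfl, hinter⟩ := hΓ
  refine exists_isArcTree_iUnion (fun i => ?_) (fun i => ?_) hinter hconn hcircle
  · obtain ⟨⟨K, hK⟩, -⟩ := harc i
    exact hK.continuousOn
  · obtain ⟨-, g, hg, -⟩ := harc i
    exact hg.injOn

theorem theorem4p3p1 (n : ℕ) (a b : ℝ) (hab : a < b) (f : Fin n → ℝ → ℝ)
    (hLip : ∀ i, ∃ K : ℝ≥0, LipschitzOnWith K (f i) (Icc a b))
    (hnonconst : ∀ i, ∃ s ∈ Icc a b, ∃ t ∈ Icc a b, f i s ≠ f i t)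
    (hzero : ∀ i, f i a = 0)
    (hΓ : IsLipschitzTriangulable (imageCurve a b f))
    (hcircle : ContainsNoCircle (imageCurve a b f))
    (hclosed : pathOf f a = pathOf f b) :
    DeterminesUniversalCenter a b f := by
  obtain ⟨K, hK⟩ := lipschitzOnWith_pathOf hLip
  have hconn : IsConnected (imageCurve a b f) :=
    (isConnected_Icc hab.le).image _ hK.continuousOn
  obtain ⟨V, hT⟩ := hΓ.exists_isArcTree hconn hcircle
  have := hT.contractibleSpace
  exact ⟨isContractibleLoop_of_contractibleSpace hab.le hK.continuousOn hclosed,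
    hT.treeCompositionCondition hK.continuousOn hclosed,
    hT.iteratedIntegralsVanish hab.le hLip hclosed⟩
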